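/- Let $\mathbb{T}=\mathbb{R}/2\pi\mathbb{Z}$, let $L^p(\mathbb{T})$ be the space of complex-valued functions with norm $\|f\|_{L^p(\mathbb{T})}=\big(\frac1{2\pi}\int_{\mathbb{T}}|f(t)|^p\,dt\big)^{1/p}$, and for $f\in L^1(\mathbb{T})$ and $n\in\mathbb{Z}$ let $\widehat f(n)=\frac1{2\pi}\int_{\mathbb{T}}f(t)e^{-int}\,dt$. The Hilbert transform on $L^2(\mathbb{T})$ is the operator $$Hf=\sum_{n=-\infty}^{\infty}\big(-i\operatorname{sign}(n)\widehat f(n)\big)e^{int},\qquad f\in L^2(\mathbb{T}),$$ where the series converges in $L^2(\mathbb{T})$ and $\operatorname{sign}(0)=0$. (a) (Weak $(1,1)$ on $L^2(\mathbb{T})$.) There exists $A>0$ such that $$|\{t\in\mathbb{T}:|(Hf)(t)|>\lambda\}|\le\frac{A}{\lambda}\|f\|_{L^1(\mathbb{T})}$$ for all $\lambda>0$ and all $f\in L^2(\mathbb{T})$, where $|E|$ denotes the Lebesgue measure of $E\subset\mathbb{T}$ (so $|\mathbb{T}|=2\pi$). (b) (Strong $(p,p)$.) For every $1<p<\infty$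 there is a unique bounded linear operator $L^p(\mathbb{T})\to L^p(\mathbb{T})$, again denoted by $H$, that agrees with the Hilbert transform on $L^2(\mathbb{T})\cap L^p(\mathbb{T})$. Thus there is a constant $C_p>0$ such that $\|Hf\|_{L^p(\mathbb{T})}\le C_p\|f\|_{L^p(\mathbb{T})}$ for all $f\in L^p(\mathbb{T})$. Moreover $$\widehat{(Hf)}(n)=-i\operatorname{sign}(n)\,\widehat f(n)\qquad\text{for all } f\in L^p(\mathbb{T}),\ n\in\mathbb{Z}.$$ -/

import Mathlib

open MeasureTheory AddCircle
open scoped ENNReal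

noncomputable section

namespace CircleHilbert

instance factTwoPiPos : Fact (0 < 2 * Real.pi) := ⟨Real.two_pi_pos⟩

/-- The torus `ℝ / 2πℤ`. -/
abbrev Torus : Type := AddCircle (2 * Real.pi)

/-- The measure `dt / 2π` on the torus. It has total mass one; the measure `volume` on the torus is
Lebesgue measure `dt`, of total mass `2π`. -/
abbrev normMeasure : Measure Torus := haarAddCircle

/-- The complex space `L^p` of the torus, with norm `(1/2π ∫ |f|^p dt)^(1/p)`. -/
abbrev LpT (p : ℝ≥0∞) : Type := Lp ℂ p normMeasure

/-- The multiplier sequence `-i sign(n)`. -/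
def multiplier (n : ℤ) : ℂ := -Complex.I * ((Int.sign n : ℤ) : ℂ)

/-- The Hilbert transform on `L^2` of the torus: the sum in `L^2` of the series
`∑ (-i sign(n) f^(n)) e^{int}`. On the torus of length `2π`, `fourierLp 2 n` is `e^{int}` and
`fourierCoeff f n` is `1/2π ∫ f(t) e^{-int} dt`. -/
def hilbertTransform (f : LpT 2) : LpT 2 :=
  ∑' n : ℤ, (multiplier n * fourierCoeff (f : Torus → ℂ) n) • fourierLp 2 n

theorem norm_multiplier_le (n : ℤ) : ‖multiplier n‖ ≤ 1 := by
  unfold multiplier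
  rcases lt_trichotomy n 0 with h | h | h
  · simp [Int.sign_eq_neg_one_of_neg h]
  · simp [h]
  · simp [Int.sign_eq_one_of_pos h]

/-- The series that defines the Hilbert transform converges (unconditionally) in `L^2`. -/
theorem hasSum_hilbertTransform (f : LpT 2) :
    HasSum (fun n : ℤ => (multiplier n * fourierCoeff (f : Torus → ℂ) n) •
      (fourierLp 2 n : LpT 2)) (hilbertTransform f) := by
  have hmem : Memℓp (fun n : ℤ => multiplier n * fourierCoeff (f : Torus → ℂ) n) 2 := by
    refine memℓp_gen ?_
    have hs : Summable fun n : ℤ => ‖fourierCoeff (f : Torus → ℂ) n‖ ^ 2 :=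
      (hasSum_sq_fourierCoeff f).summable
    refine Summable.of_nonneg_of_le (fun n => by positivity) (fun n => ?_) hs
    have h : ‖multiplier n * fourierCoeff (f : Torus → ℂ) n‖ ≤
        ‖fourierCoeff (f : Torus → ℂ) n‖ := by
      rw [norm_mul]
      exact mul_le_of_le_one_left (norm_nonneg _) (norm_multiplier_le n)
    simpa using pow_le_pow_left₀ (norm_nonneg _) h 2
  have h := HilbertBasis.hasSum_repr_symm (fourierBasis (T := 2 * Real.pi))
    (⟨_, hmem⟩ : lp (fun _ : ℤ => ℂ) 2)
  rw [coe_fourierBasis] at h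
  exact h.summable.hasSum

/-- The operator `T` on `L^p` extends the Hilbert transform: it agrees with it on `L^2 ∩ L^p`. -/
def ExtendsHilbertTransform (p : ℝ≥0∞) (T : LpT p → LpT p) : Prop :=
  ∀ (f : LpT 2) (g : LpT p), (f : Torus → ℂ) =ᵐ[normMeasure] (g : Torus → ℂ) →
    (T g : Torus → ℂ) =ᵐ[normMeasure] (hilbertTransform f : Torus → ℂ)

end CircleHilbert

end

noncomputable section

namespace CircleHilbert

/-! The argument is complex-analytic. For a positive trigonometric polynomial `u`, the sum `u + iHu`
is the boundary value of a polynomial `Q` whose real part is positive on the closed disc, with `Q 0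
= ∫ u = ‖u‖₁`. The mean value property can then be applied to holomorphic functions of `Q`. Applied
to `Q / (Q + l)` it gives the weak (1,1) bound (`measureReal_le_norm_entire`). Applied to `Q ^ p` it
gives the strong bound for `1 < p ≤ 2`, by a pointwise inequality in the right half-plane
(`exists_norm_rpow_le`).

Positive trigonometric polynomials are dense in the nonnegative functions of `L²`
(`IsNonneg.mem_closure`), and each `f` in `L²` is a combination of four such functions dominated by
`|f|`, so both bounds pass to `L²`. For `p > 2`, skew-adjointness of `H` and Hölder's inequality
reduce to the conjugate exponent. Density of trigonometric polynomials in `L^p` then gives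
existence, uniqueness and the coefficient formula. -/

/-! ### The Hilbert transform as a Fourier multiplier on `L²`. -/

theorem fourierCoeff_Lp_add (f g : LpT 2) (n : ℤ) :
    fourierCoeff ((f + g : LpT 2) : Torus → ℂ) n =
      fourierCoeff (f : Torus → ℂ) n + fourierCoeff (g : Torus → ℂ) n := by
  simp only [← fourierBasis_repr, map_add, lp.coeFn_add, Pi.add_apply]

theorem fourierCoeff_Lp_smul (c : ℂ) (f : LpT 2) (n : ℤ) :
    fourierCoeff ((c • f : LpT 2) : Torus → ℂ) n = c * fourierCoeff (f : Torus → ℂ) n := by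
  simp only [← fourierBasis_repr, map_smul, lp.coeFn_smul, Pi.smul_apply, smul_eq_mul]

theorem fourierCoeff_hilbertTransform (f : LpT 2) (n : ℤ) :
    fourierCoeff (hilbertTransform f : Torus → ℂ) n =
      multiplier n * fourierCoeff (f : Torus → ℂ) n := by
  have h := ((fourierBasis (T := 2 * Real.pi)).repr.toContinuousLinearEquiv.toContinuousLinearMap.hasSum
    (hasSum_hilbertTransform f))
  have h2 := (lp.evalCLM ℂ (fun _ : ℤ => ℂ) 2 n).hasSum h
  have hev (g : LpT 2) : lp.evalCLM ℂ (fun _ : ℤ => ℂ) 2 n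
      ((fourierBasis (T := 2 * Real.pi)).repr g) = fourierCoeff (g : Torus → ℂ) n :=
    fourierBasis_repr g n
  have h3 := h2.unique (hasSum_single n ?_)
  · refine (hev _).symm.trans (h3.trans ((hev _).trans ?_))
    rw [fourierCoeff_Lp_smul, fourierCoeff_toLp, fourierCoeff_fourier]
    simp
  · intro m hm
    refine (hev _).trans ?_
    rw [fourierCoeff_Lp_smul, fourierCoeff_toLp, fourierCoeff_fourier]
    simp [hm.symm]

theorem ext_fourierCoeff {f g : LpT 2}
    (h : ∀ n, fourierCoeff (f : Torus → ℂ) n = fourierCoeff (g : Torus → ℂ) n) : f = g := by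
  apply (fourierBasis (T := 2 * Real.pi)).repr.injective
  ext n
  simpa only [fourierBasis_repr] using h n

theorem norm_hilbertTransform_le (f : LpT 2) : ‖hilbertTransform f‖ ≤ ‖f‖ := by
  rw [← (fourierBasis (T := 2 * Real.pi)).repr.norm_map f,
    ← (fourierBasis (T := 2 * Real.pi)).repr.norm_map (hilbertTransform f)]
  refine lp.norm_mono (by simp) fun n => ?_
  rw [fourierBasis_repr, fourierBasis_repr, fourierCoeff_hilbertTransform, norm_mul]
  exact mul_le_of_le_one_left (norm_nonneg _) (norm_multiplier_le n)

/-- The Hilbert transform on `L^2` as a continuous linear map. -/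
def hilbertL : LpT 2 →L[ℂ] LpT 2 :=
  LinearMap.mkContinuous
    { toFun := hilbertTransform
      map_add' := fun f g => ext_fourierCoeff fun n => by
        simp only [fourierCoeff_hilbertTransform, fourierCoeff_Lp_add, mul_add]
      map_smul' := fun c f => ext_fourierCoeff fun n => by
        simp only [fourierCoeff_hilbertTransform, fourierCoeff_Lp_smul, RingHom.id_apply]
        ring } 1 (fun f => by simpa using norm_hilbertTransform_le f)

theorem hilbertL_apply (f : LpT 2) : hilbertL f = hilbertTransform f := rfl

theorem hilbertTransform_fourierLp (n : ℤ) :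
    hilbertTransform (fourierLp 2 n) = multiplier n • fourierLp 2 n := by
  refine ext_fourierCoeff fun m => ?_
  rw [fourierCoeff_hilbertTransform, fourierCoeff_Lp_smul, fourierCoeff_toLp, fourierCoeff_fourier]
  rcases eq_or_ne m n with rfl | h
  · rfl
  · simp [h]

theorem conj_multiplier (n : ℤ) : (starRingEnd ℂ) (multiplier n) = -multiplier n := by
  simp [multiplier]

theorem multiplier_neg (n : ℤ) : multiplier (-n) = -multiplier n := by
  simp [multiplier]

/-- The multiplier is purely imaginary, so by Parseval `H` is skew-adjoint. The duality argument for
`p > 2` rests on this. -/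
theorem inner_hilbertTransform_left (f g : LpT 2) :
    inner ℂ (hilbertTransform f) g = -inner ℂ f (hilbertTransform g) := by
  rw [← (fourierBasis (T := 2 * Real.pi)).repr.inner_map_map,
    ← (fourierBasis (T := 2 * Real.pi)).repr.inner_map_map, lp.inner_eq_tsum, lp.inner_eq_tsum,
    ← tsum_neg]
  refine tsum_congr fun n => ?_
  simp only [fourierBasis_repr, fourierCoeff_hilbertTransform, RCLike.inner_apply, map_mul,
    conj_multiplier]
  ring

/-! ### Holomorphic functions on the disc and their values on the circle. -/

theorem toCircle_coe_real (x : ℝ) :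
    ((toCircle (x : Torus) : Circle) : ℂ) = Complex.exp (x * Complex.I) := by
  have h := fourier_coe_apply (T := 2 * Real.pi) (n := 1) (x := x)
  rw [fourier_one] at h
  rw [h]
  congr 1
  have : (Real.pi : ℂ) ≠ 0 := by exact_mod_cast Real.pi_ne_zero
  push_cast
  field_simp

theorem integral_comp_toCircle {G : ℂ → ℂ} (hG : DiffContOnCl ℂ G (Metric.ball 0 1)) :
    ∫ t : Torus, G (toCircle t) ∂normMeasure = G 0 := by
  have h := DiffContOnCl.circleAverage (c := 0) (R := 1) (f := G) (by simpa using hG)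
  rw [← h, integral_haarAddCircle, Real.circleAverage_def,
    ← AddCircle.intervalIntegral_preimage (2 * Real.pi) 0, zero_add]
  simp only [toCircle_coe_real, circleMap, Complex.ofReal_one, one_mul, zero_add]

theorem continuous_coe_toCircle : Continuous fun t : Torus => ((toCircle t : Circle) : ℂ) := by
  simp_rw [← fourier_one]
  exact (fourier (T := 2 * Real.pi) 1).continuous

theorem exists_toCircle_eq {z : ℂ} (hz : ‖z‖ = 1) : ∃ t : Torus, (toCircle t : ℂ) = z := by
  refine ⟨(z.arg : ℝ), ?_⟩
  rw [toCircle_coe_real]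
  simpa [hz] using Complex.norm_mul_exp_arg_mul_I z

/-- Maximum modulus for `exp (-Q)`, whose modulus is `exp (-Re Q)`. By compactness `Re Q` attains
its minimum on the circle, which keeps the inequality strict inside. -/
theorem re_pos_of_re_pos_on_circle {Q : ℂ → ℂ} (hQ : Differentiable ℂ Q)
    (h : ∀ t : Torus, 0 < (Q (toCircle t)).re) {z : ℂ} (hz : z ∈ Metric.closedBall (0 : ℂ) 1) :
    0 < (Q z).re := by
  obtain ⟨t₀, -, ht₀⟩ := (isCompact_univ (X := Torus)).exists_isMinOn Set.univ_nonempty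
    (f := fun t : Torus => (Q (toCircle t)).re)
    (by
      apply Continuous.continuousOn
      exact Complex.continuous_re.comp (hQ.continuous.comp continuous_coe_toCircle))
  have key : ‖Complex.exp (-Q z)‖ ≤ Real.exp (-(Q (toCircle t₀)).re) := by
    refine Complex.norm_le_of_forall_mem_frontier_norm_le (f := fun z => Complex.exp (-Q z))
      (U := Metric.ball (0 : ℂ) 1) Metric.isBounded_ball
      (hQ.neg.cexp.diffContOnCl) (fun w hw => ?_)
      (by rwa [closure_ball _ one_ne_zero])
    rw [frontier_ball _ one_ne_zero, mem_sphere_zero_iff_norm] at hw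
    obtain ⟨t, rfl⟩ := exists_toCircle_eq hw
    rw [Complex.norm_exp, Complex.neg_re]
    exact Real.exp_le_exp.2 (neg_le_neg (ht₀ (Set.mem_univ t)))
  rw [Complex.norm_exp, Complex.neg_re, Real.exp_le_exp] at key
  linarith [h t₀]

/-! ### Positive trigonometric polynomials and their analytic completion. -/

theorem exists_finsupp_of_mem_fourierSubalgebra {u : C(Torus, ℂ)}
    (hu : u ∈ fourierSubalgebra (T := 2 * Real.pi)) :
    ∃ c : ℤ →₀ ℂ, ∑ n ∈ c.support, c n • fourier n = u := by
  have h : u ∈ Subalgebra.toSubmodule (fourierSubalgebra (T := 2 * Real.pi)).toSubalgebra := hu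
  rw [fourierSubalgebra_coe, Finsupp.mem_span_range_iff_exists_finsupp] at h
  exact h

theorem fourierCoeff_sum_fourier (c : ℤ →₀ ℂ) (m : ℤ) :
    fourierCoeff (fun t : Torus => ∑ n ∈ c.support, c n * fourier n t) m = c m := by
  have h := fourierCoeff.sum (T := 2 * Real.pi) c.support
    (fun n t => c n * fourier n t) (fun n _ => Continuous.integrable_of_hasCompactSupport
      (by fun_prop) (HasCompactSupport.of_compactSpace _))
  have h2 := congrFun h m
  have h3 : (∑ n ∈ c.support, fun t : Torus => c n * fourier n t) =
      (fun t : Torus => ∑ n ∈ c.support, c n * fourier n t) := by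
    ext t; simp
  rw [h3] at h2
  rw [h2, Finset.sum_apply]
  simp only [fourierCoeff.const_mul, fourierCoeff_fourier, Pi.single_apply]
  simpa using fun h => h.symm

theorem fourierCoeff_neg_of_im_eq_zero {u : Torus → ℂ} (hu : ∀ t, (u t).im = 0) (n : ℤ) :
    fourierCoeff u (-n) = (starRingEnd ℂ) (fourierCoeff u n) := by
  simp only [fourierCoeff]
  rw [← integral_conj]
  refine integral_congr_ae (Filter.Eventually.of_forall fun t => ?_)
  have h : (starRingEnd ℂ) (u t) = u t := Complex.conj_eq_iff_im.2 (hu t)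
  simp only [smul_eq_mul, map_mul, h, ← fourier_neg]

/-- A trigonometric polynomial all of whose values are positive real numbers. -/
def IsPosTrig (u : C(Torus, ℂ)) : Prop :=
  u ∈ fourierSubalgebra (T := 2 * Real.pi) ∧ ∀ t, 0 < (u t).re ∧ (u t).im = 0

/-- A positive trigonometric polynomial `u` is the real part of an entire function `Q` on the unit
circle, whose imaginary part there is the Hilbert transform of `u`. -/
theorem IsPosTrig.exists_entire {u : C(Torus, ℂ)} (hu : IsPosTrig u) :
    ∃ Q : ℂ → ℂ, Differentiable ℂ Q ∧ Q 0 = ∫ t, u t ∂normMeasure ∧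
      (∀ t : Torus, (Q (toCircle t)).re = (u t).re) ∧
      (hilbertTransform (u.toLp 2 normMeasure ℂ) : Torus → ℂ) =ᵐ[normMeasure]
        fun t => ((Q (toCircle t)).im : ℂ) := by
  obtain ⟨c, rfl⟩ := exists_finsupp_of_mem_fourierSubalgebra hu.1
  set u : C(Torus, ℂ) := ∑ n ∈ c.support, c n • fourier n with hudef
  set v : C(Torus, ℂ) := ∑ n ∈ c.support, (multiplier n * c n) • fourier n with hvdef
  have hut (t : Torus) : u t = ∑ n ∈ c.support, c n * fourier n t := by
    simp only [hudef, ContinuousMap.coe_sum, ContinuousMap.coe_smul, Finset.sum_apply,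
      Pi.smul_apply, smul_eq_mul]
  have hvt (t : Torus) : v t = ∑ n ∈ c.support, (multiplier n * c n) * fourier n t := by
    simp only [hvdef, ContinuousMap.coe_sum, ContinuousMap.coe_smul, Finset.sum_apply,
      Pi.smul_apply, smul_eq_mul]
  have hcoeff (n : ℤ) : fourierCoeff u n = c n := by
    rw [← fourierCoeff_sum_fourier c n]
    exact congrArg (fun f => fourierCoeff f n) (funext hut)
  have hconj (n : ℤ) : c (-n) = (starRingEnd ℂ) (c n) := by
    rw [← hcoeff, ← hcoeff]
    exact fourierCoeff_neg_of_im_eq_zero (fun t => (hu.2 t).2) n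
  have hH : hilbertTransform (u.toLp 2 normMeasure ℂ) = v.toLp 2 normMeasure ℂ := by
    rw [← hilbertL_apply, hudef, hvdef]
    simp only [map_sum, map_smul]
    refine Finset.sum_congr rfl fun n _ => ?_
    rw [hilbertL_apply, hilbertTransform_fourierLp, smul_smul, mul_comm (c n)]
  -- Both `c` and the multiplier turn `n ↦ -n` into conjugation, so conjugating the sum only
  -- reindexes it.
  have hvreal (t : Torus) : (v t).im = 0 := by
    rw [← Complex.conj_eq_iff_im, hvt, map_sum]
    refine Finset.sum_bij' (fun n _ => -n) (fun n _ => -n) ?_ ?_ ?_ ?_ ?_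
    · intro n hn
      simpa [hconj] using hn
    · intro n hn
      simpa [hconj] using hn
    · simp
    · simp
    · intro n _
      simp only [map_mul, ← fourier_neg, conj_multiplier, multiplier_neg, hconj]
  -- The factor `1 + i · multiplier n` is `1 + sign n`, that is 2, 1 or 0. Negative frequencies
  -- vanish, so the value of `n.toNat` there is irrelevant.
  refine ⟨fun z => ∑ n ∈ c.support, (c n * (1 + Complex.I * multiplier n)) * z ^ n.toNat,
    by fun_prop, ?_, ?_⟩
  · have h0 : ∫ t, u t ∂normMeasure = c 0 := by
      rw [← hcoeff]
      simp [fourierCoeff]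
    beta_reduce
    rw [h0, Finset.sum_eq_single 0]
    · simp [multiplier]
    · intro n _ hn
      rcases lt_or_gt_of_ne hn with h | h
      · simp [multiplier, Int.sign_eq_neg_one_of_neg h]
      · rw [zero_pow (by omega), mul_zero]
    · intro h
      simp [Finsupp.notMem_support_iff.1 h]
  · have hQ (t : Torus) : ∑ n ∈ c.support, (c n * (1 + Complex.I * multiplier n)) *
        (toCircle t : ℂ) ^ n.toNat = u t + Complex.I * v t := by
      rw [hut, hvt, Finset.mul_sum, ← Finset.sum_add_distrib]
      refine Finset.sum_congr rfl fun n _ => ?_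
      rcases lt_or_ge n 0 with h | h
      · simp [multiplier, Int.sign_eq_neg_one_of_neg h]
        ring_nf
        simp
      · have : (toCircle t : ℂ) ^ n.toNat = fourier n t := by
          lift n to ℕ using h
          rw [fourier_apply, Int.toNat_natCast, natCast_zsmul, toCircle_nsmul, Circle.coe_pow]
        rw [this]
        ring
    refine ⟨fun t => ?_, ?_⟩
    · beta_reduce
      rw [hQ]
      simp [hvreal t]
    · rw [hH]
      filter_upwards [ContinuousMap.coeFn_toLp (p := 2) (𝕜 := ℂ) normMeasure v] with t ht
      rw [ht, hQ]
      apply Complex.ext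
      · simp [(hu.2 t).2]
      · simp [hvreal t]

/-! ### Weak (1,1) bound for positive trigonometric polynomials. -/

/-- The map `w ↦ w / (w + l)` sends the right half-plane onto the disc with diameter `[0, 1]`, and
the half-circle `‖w‖ = l` to the line `Re = 1/2`. -/
theorem half_le_re_div_add {w : ℂ} (hw : 0 < w.re) {l : ℝ} (hl : 0 < l) (h : l ≤ ‖w‖) :
    1 / 2 ≤ (w / (w + l)).re := by
  have hsq : w.re ^ 2 + w.im ^ 2 = ‖w‖ ^ 2 := by
    rw [← Complex.normSq_eq_norm_sq, Complex.normSq_apply]; ring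
  have h2 : l ^ 2 ≤ ‖w‖ ^ 2 := by gcongr
  have hpos : 0 < Complex.normSq (w + l) := by
    rw [Complex.normSq_pos]
    intro h0
    have := congrArg Complex.re h0
    simp at this
    linarith
  rw [Complex.div_re, ← add_div, le_div_iff₀ hpos, Complex.normSq_apply]
  simp
  nlinarith

theorem re_div_add_nonneg {w : ℂ} (hw : 0 < w.re) {l : ℝ} (hl : 0 < l) :
    0 ≤ (w / (w + l)).re := by
  rw [Complex.div_re, ← add_div]
  refine div_nonneg ?_ (Complex.normSq_nonneg _)
  simp
  nlinarith [mul_pos hw hl, sq_nonneg w.re, sq_nonneg w.im]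

/-- The mean of `Re (Q / (Q + l))` over the circle is its value at the centre, `a / (a + l) ≤ a /
l`. The integrand is nonnegative and at least `1/2` where `‖Q‖ ≥ l`, so Markov's inequality gives
the factor 2. -/
theorem measureReal_le_norm_entire {Q : ℂ → ℂ} (hQ : Differentiable ℂ Q)
    (hre : ∀ t : Torus, 0 < (Q (toCircle t)).re) {a : ℝ} (ha : Q 0 = a) {l : ℝ} (hl : 0 < l) :
    normMeasure.real {t : Torus | l ≤ ‖Q (toCircle t)‖} ≤ 2 / l * a := by
  have hpos {z : ℂ} (hz : z ∈ Metric.closedBall (0 : ℂ) 1) : 0 < (Q z).re :=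
    re_pos_of_re_pos_on_circle hQ hre hz
  have hne {z : ℂ} (hz : z ∈ Metric.closedBall (0 : ℂ) 1) : Q z + l ≠ 0 := fun h => by
    have h1 := congrArg Complex.re h
    simp only [Complex.add_re, Complex.ofReal_re, Complex.zero_re] at h1
    linarith [hpos hz]
  have hcl : closure (Metric.ball (0 : ℂ) 1) = Metric.closedBall 0 1 :=
    closure_ball _ one_ne_zero
  have hG : DiffContOnCl ℂ (fun z => Q z / (Q z + l)) (Metric.ball 0 1) := by
    refine DifferentiableOn.diffContOnCl ?_
    rw [hcl]
    intro z hz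
    exact ((hQ z).div ((hQ z).add_const _) (hne hz)).differentiableWithinAt
  have hmem (t : Torus) : (toCircle t : ℂ) ∈ Metric.closedBall (0 : ℂ) 1 :=
    mem_closedBall_zero_iff.2 (Circle.norm_coe _).le
  have hcont : Continuous fun t : Torus => Q (toCircle t) / (Q (toCircle t) + l) :=
    Continuous.div (hQ.continuous.comp continuous_coe_toCircle)
      ((hQ.continuous.comp continuous_coe_toCircle).add continuous_const) fun t => hne (hmem t)
  have hint : Integrable (fun t : Torus => Q (toCircle t) / (Q (toCircle t) + l)) normMeasure :=
    hcont.integrable_of_hasCompactSupport (HasCompactSupport.of_compactSpace _)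
  have hmvp := congrArg Complex.re (integral_comp_toCircle hG)
  rw [show (∫ t : Torus, Q (toCircle t) / (Q (toCircle t) + l) ∂normMeasure).re =
    ∫ t : Torus, (Q (toCircle t) / (Q (toCircle t) + l)).re ∂normMeasure from
      (integral_re hint).symm] at hmvp
  have hmarkov := mul_meas_ge_le_integral_of_nonneg (μ := normMeasure)
    (f := fun t : Torus => (Q (toCircle t) / (Q (toCircle t) + l)).re)
    (Filter.Eventually.of_forall fun t => re_div_add_nonneg (hre t) hl) hint.re (1 / 2)
  have ha0 : 0 < a := by
    have := hpos (z := 0) (by simp)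
    simpa [ha] using this
  have hval : (Q 0 / (Q 0 + l)).re ≤ a / l := by
    rw [ha, ← Complex.ofReal_add, ← Complex.ofReal_div, Complex.ofReal_re]
    gcongr
    linarith
  have hmono : normMeasure.real {t : Torus | l ≤ ‖Q (toCircle t)‖} ≤
      normMeasure.real {t : Torus | 1 / 2 ≤ (Q (toCircle t) / (Q (toCircle t) + l)).re} :=
    measureReal_mono fun t ht => half_le_re_div_add (hre t) hl ht
  have : 2 / l * a = 2 * (a / l) := by ring
  linarith

theorem IsPosTrig.norm_eq {u : C(Torus, ℂ)} (hu : IsPosTrig u) (t : Torus) :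
    ‖u t‖ = (u t).re := by
  have : u t = ((u t).re : ℂ) := Complex.ext rfl (by simpa using (hu.2 t).2)
  rw [this, Complex.norm_real, Complex.ofReal_re, Real.norm_of_nonneg (hu.2 t).1.le]

theorem integrable_continuousMap {E : Type*} [NormedAddCommGroup E] {u : Torus → E}
    (hu : Continuous u) : Integrable u normMeasure :=
  hu.integrable_of_hasCompactSupport (HasCompactSupport.of_compactSpace _)

theorem IsPosTrig.integral_eq {u : C(Torus, ℂ)} (hu : IsPosTrig u) :
    ∫ t, u t ∂normMeasure = ((∫ t, ‖u t‖ ∂normMeasure : ℝ) : ℂ) := by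
  rw [← integral_complex_ofReal]
  refine integral_congr_ae (Filter.Eventually.of_forall fun t => ?_)
  simp only [hu.norm_eq]
  exact Complex.ext rfl (by simpa using (hu.2 t).2)

theorem IsPosTrig.measure_le {u : C(Torus, ℂ)} (hu : IsPosTrig u) {l : ℝ} (hl : 0 < l) :
    normMeasure {t : Torus | l ≤ ‖hilbertTransform (u.toLp 2 normMeasure ℂ) t‖} ≤
      ENNReal.ofReal (2 / l) * eLpNorm u 1 normMeasure := by
  obtain ⟨Q, hQ, hQ0, hre, him⟩ := hu.exists_entire
  rw [hu.integral_eq] at hQ0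
  have h := measureReal_le_norm_entire hQ (fun t => by rw [hre]; exact (hu.2 t).1) hQ0 hl
  have hle : normMeasure {t : Torus | l ≤ ‖hilbertTransform (u.toLp 2 normMeasure ℂ) t‖} ≤
      normMeasure {t : Torus | l ≤ ‖Q (toCircle t)‖} := by
    refine measure_mono_ae ?_
    filter_upwards [him] with t ht h1
    change l ≤ ‖_‖ at h1
    rw [ht, Complex.norm_real, Real.norm_eq_abs] at h1
    exact h1.trans (Complex.abs_im_le_norm _)
  refine hle.trans ?_
  rw [eLpNorm_one_eq_lintegral_enorm, ← ofReal_integral_norm_eq_lintegral_enorm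
    (integrable_continuousMap u.continuous), ← ENNReal.ofReal_mul (by positivity),
    ← ofReal_measureReal]
  exact ENNReal.ofReal_le_ofReal h

/-! ### Strong bound for positive trigonometric polynomials, `1 < p ≤ 2`. -/

/-- With `θ = |arg w|`, `Re (w ^ p) = ‖w‖ ^ p cos (pθ)`. Near `θ = π/2` this cosine is negative,
since `π/2 < pπ/2 ≤ π`, and the `B` term suffices; elsewhere `cos θ` is bounded below and the `A`
term suffices. -/
theorem exists_norm_rpow_le {p : ℝ} (hp : 1 < p) (hp2 : p ≤ 2) :
    ∃ A B : ℝ, 0 ≤ A ∧ 0 ≤ B ∧ ∀ w : ℂ, 0 < w.re →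
      ‖w‖ ^ p ≤ A * w.re ^ p - B * (w ^ (p : ℂ)).re := by
  obtain ⟨c, hc⟩ : ∃ c, c = -Real.cos (p * (Real.pi / 2)) := ⟨_, rfl⟩
  have hpi := Real.pi_pos
  have hc0 : 0 < c := by
    rw [hc, neg_pos]
    exact Real.cos_neg_of_pi_div_two_lt_of_lt (by nlinarith) (by nlinarith)
  have hδ : 0 < c / (p * Real.pi) := by positivity
  -- The threshold `cos θ = c / (pπ)` is where the bound `-c + (pπ/2) cos θ` on `cos (pθ)` reaches
  -- `-c/2`; hence `B = 2 / c`.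
  refine ⟨(1 + 2 / c) / (c / (p * Real.pi)) ^ p, 2 / c, by positivity, by positivity,
    fun w hw => ?_⟩
  have hcos : w.re = ‖w‖ * Real.cos |w.arg| := by
    rw [Real.cos_abs, Complex.norm_mul_cos_arg]
  have hn : 0 < ‖w‖ := norm_pos_iff.2 fun h => by simp [h] at hw
  have harg : |w.arg| < Real.pi / 2 := Complex.abs_arg_lt_pi_div_two_iff.2 (Or.inl hw)
  have hpow : (w ^ (p : ℂ)).re = ‖w‖ ^ p * Real.cos (p * |w.arg|) := by
    rw [Complex.cpow_ofReal_re, mul_comm p, ← Real.cos_abs (w.arg * p), abs_mul,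
      abs_of_pos (by linarith : 0 < p)]
  have hθ := abs_nonneg w.arg
  generalize |w.arg| = θ at *
  have hs0 : 0 < Real.cos θ := by
    rw [hcos] at hw
    exact pos_of_mul_pos_right hw hn.le
  rw [hpow, hcos, Real.mul_rpow hn.le hs0.le]
  suffices h : 1 ≤ (1 + 2 / c) / (c / (p * Real.pi)) ^ p * Real.cos θ ^ p
      - 2 / c * Real.cos (p * θ) by
    have := mul_le_mul_of_nonneg_left h (Real.rpow_nonneg hn.le p)
    linarith
  -- Cosine is 1-Lipschitz, and Jordan's inequality bounds `π/2 - θ` by `(π/2) cos θ`.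
  have hlip : Real.cos (p * θ) ≤ -c + p * (Real.pi / 2) * Real.cos θ := by
    have h1 : Real.cos (p * θ) - Real.cos (p * (Real.pi / 2)) ≤ p * (Real.pi / 2 - θ) := by
      have := Real.abs_cos_sub_cos_le (p * θ) (p * (Real.pi / 2))
      have h3 : |p * θ - p * (Real.pi / 2)| = p * (Real.pi / 2 - θ) := by
        rw [← mul_sub, abs_mul, abs_of_pos (by linarith : 0 < p), abs_sub_comm,
          abs_of_pos (by linarith)]
      exact (le_abs_self _).trans (this.trans h3.le)
    have h2 : 2 / Real.pi * (Real.pi / 2 - θ) ≤ Real.cos θ := by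
      rw [← Real.sin_pi_div_two_sub]
      exact Real.mul_le_sin (by linarith) (by linarith)
    have h3 : Real.pi / 2 - θ ≤ Real.pi / 2 * Real.cos θ := by
      have := mul_le_mul_of_nonneg_left h2 (by positivity : 0 ≤ Real.pi / 2)
      have h4 : Real.pi / 2 * (2 / Real.pi * (Real.pi / 2 - θ)) = Real.pi / 2 - θ := by
        field_simp
      linarith
    nlinarith
  rcases le_or_gt (Real.cos θ) (c / (p * Real.pi)) with h | h
  · have h1 : p * (Real.pi / 2) * Real.cos θ ≤ c / 2 := by
      rw [le_div_iff₀ (by positivity)] at h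
      linarith
    have h2 : 2 / c * Real.cos (p * θ) ≤ 2 / c * (-(c / 2)) := by
      gcongr
      linarith
    have h3 : 2 / c * (-(c / 2)) = -1 := by field_simp
    have h4 : 0 ≤ (1 + 2 / c) / (c / (p * Real.pi)) ^ p * Real.cos θ ^ p := by positivity
    linarith
  · have h1 : (c / (p * Real.pi)) ^ p ≤ Real.cos θ ^ p := by gcongr
    have h2 : 1 + 2 / c ≤ (1 + 2 / c) / (c / (p * Real.pi)) ^ p * Real.cos θ ^ p := by
      rw [div_mul_eq_mul_div, le_div_iff₀ (by positivity)]
      gcongr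
    have h3 : 2 / c * Real.cos (p * θ) ≤ 2 / c * 1 := by
      gcongr
      exact Real.cos_le_one _
    linarith

/-- Integrate the pointwise inequality at `w = Q`. The mean of `Re (Q ^ p)` is `(∫ u) ^ p ≥ 0`, so
the term with `B` can be dropped. -/
theorem IsPosTrig.exists_eLpNorm_le {p : ℝ≥0∞} (hp : 1 < p) (hp2 : p ≤ 2) :
    ∃ C : ℝ, 0 ≤ C ∧ ∀ u : C(Torus, ℂ), IsPosTrig u →
      eLpNorm (hilbertTransform (u.toLp 2 normMeasure ℂ)) p normMeasure ≤
        ENNReal.ofReal C * eLpNorm u p normMeasure := by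
  have hptop : p ≠ ∞ := ne_top_of_le_ne_top (by simp) hp2
  have hp0 : p ≠ 0 := (zero_lt_one.trans hp).ne'
  obtain ⟨r, hr⟩ : ∃ r, r = p.toReal := ⟨_, rfl⟩
  have hr1 : 1 < r := by
    rw [hr, ← ENNReal.toReal_one]
    exact (ENNReal.toReal_lt_toReal (by simp) hptop).2 hp
  have hr2 : r ≤ 2 := by
    rw [hr, ← ENNReal.toReal_ofNat]
    exact (ENNReal.toReal_le_toReal hptop (by simp)).2 hp2
  obtain ⟨A, B, hA, hB, hAB⟩ := exists_norm_rpow_le hr1 hr2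
  refine ⟨A ^ r⁻¹, by positivity, fun u hu => ?_⟩
  obtain ⟨Q, hQ, hQ0, hre, him⟩ := hu.exists_entire
  rw [hu.integral_eq] at hQ0
  have hQre (t : Torus) : 0 < (Q (toCircle t)).re := by rw [hre]; exact (hu.2 t).1
  have hpos {z : ℂ} (hz : z ∈ Metric.closedBall (0 : ℂ) 1) : 0 < (Q z).re :=
    re_pos_of_re_pos_on_circle hQ hQre hz
  have hQc : Continuous fun t : Torus => Q (toCircle t) :=
    hQ.continuous.comp continuous_coe_toCircle
  have hG : DiffContOnCl ℂ (fun z => Q z ^ (r : ℂ)) (Metric.ball 0 1) := by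
    refine DifferentiableOn.diffContOnCl ?_
    rw [closure_ball _ one_ne_zero]
    intro z hz
    exact ((hQ z).cpow_const (Or.inl (hpos hz))).differentiableWithinAt
  have hGc : Continuous fun t : Torus => Q (toCircle t) ^ (r : ℂ) :=
    hQc.cpow continuous_const fun t => Or.inl (hQre t)
  have hmvp := congrArg Complex.re (integral_comp_toCircle hG)
  rw [show (∫ t : Torus, Q (toCircle t) ^ (r : ℂ) ∂normMeasure).re =
    ∫ t : Torus, (Q (toCircle t) ^ (r : ℂ)).re ∂normMeasure from
      (integral_re (integrable_continuousMap hGc)).symm] at hmvp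
  have hGre : Continuous fun t : Torus => (Q (toCircle t) ^ (r : ℂ)).re :=
    Complex.continuous_re.comp hGc
  have hr0 : 0 ≤ r := by linarith
  have h0 : 0 ≤ (Q 0 ^ (r : ℂ)).re := by
    rw [hQ0, ← Complex.ofReal_cpow (integral_nonneg fun t => norm_nonneg _), Complex.ofReal_re]
    exact Real.rpow_nonneg (integral_nonneg fun t => norm_nonneg _) _
  have hic : Continuous fun t : Torus => ‖((Q (toCircle t)).im : ℂ)‖ ^ r :=
    (Complex.continuous_ofReal.comp (Complex.continuous_im.comp hQc)).norm.rpow_const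
      fun _ => Or.inr hr0
  have huc : Continuous fun t : Torus => ‖u t‖ ^ r :=
    u.continuous.norm.rpow_const fun _ => Or.inr hr0
  have hmain : ∫ t : Torus, ‖((Q (toCircle t)).im : ℂ)‖ ^ r ∂normMeasure ≤
      A * ∫ t : Torus, ‖u t‖ ^ r ∂normMeasure := by
    calc ∫ t : Torus, ‖((Q (toCircle t)).im : ℂ)‖ ^ r ∂normMeasure
      _ ≤ ∫ t : Torus, (A * ‖u t‖ ^ r - B * (Q (toCircle t) ^ (r : ℂ)).re) ∂normMeasure := by
        refine integral_mono (integrable_continuousMap hic) (integrable_continuousMap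
          ((huc.const_mul A).sub (hGre.const_mul B))) fun t => ?_
        refine le_trans ?_ ((hAB _ (hQre t)).trans_eq (by rw [hre, hu.norm_eq]))
        rw [Complex.norm_real]
        exact Real.rpow_le_rpow (norm_nonneg _) (Complex.abs_im_le_norm _) hr0
      _ = A * ∫ t : Torus, ‖u t‖ ^ r ∂normMeasure - B * (Q 0 ^ (r : ℂ)).re := by
        rw [integral_sub (integrable_continuousMap (huc.const_mul A))
          (integrable_continuousMap (hGre.const_mul B)),
          integral_const_mul, integral_const_mul, hmvp]
      _ ≤ _ := by linarith [mul_nonneg hB h0]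
  rw [eLpNorm_congr_ae him]
  have hm1 : MemLp (fun t : Torus => ((Q (toCircle t)).im : ℂ)) p normMeasure :=
    Continuous.memLp_of_hasCompactSupport (Complex.continuous_ofReal.comp
      (Complex.continuous_im.comp hQc)) (HasCompactSupport.of_compactSpace _)
  have hm2 : MemLp u p normMeasure :=
    u.continuous.memLp_of_hasCompactSupport (HasCompactSupport.of_compactSpace _)
  rw [hm1.eLpNorm_eq_integral_rpow_norm hp0 hptop, hm2.eLpNorm_eq_integral_rpow_norm hp0 hptop,
    ← ENNReal.ofReal_mul (by positivity), ← hr,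
    ← Real.mul_rpow hA (integral_nonneg fun t => by positivity)]
  refine ENNReal.ofReal_le_ofReal (Real.rpow_le_rpow (integral_nonneg fun t => by positivity)
    hmain (by positivity))

/-! ### Inclusions between the spaces `L^p`. -/

/-- The inclusion of `L^q` into `L^p` for `p ≤ q`. -/
def inclLp {p q : ℝ≥0∞} [Fact (1 ≤ p)] [Fact (1 ≤ q)] (h : p ≤ q) : LpT q →L[ℂ] LpT p :=
  LinearMap.mkContinuous
    { toFun := fun f => ((Lp.memLp f).mono_exponent h).toLp f
      map_add' := fun f g => by
        rw [← MemLp.toLp_add, MemLp.toLp_eq_toLp_iff]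
        exact Lp.coeFn_add f g
      map_smul' := fun c f => by
        rw [RingHom.id_apply, ← MemLp.toLp_const_smul, MemLp.toLp_eq_toLp_iff]
        exact Lp.coeFn_smul c f } 1 (fun f => by
      simp only [LinearMap.coe_mk, AddHom.coe_mk, one_mul]
      rw [Lp.norm_toLp, Lp.norm_def]
      exact ENNReal.toReal_mono (Lp.eLpNorm_ne_top f)
        (eLpNorm_le_eLpNorm_of_exponent_le h (Lp.aestronglyMeasurable f)))

theorem coeFn_inclLp {p q : ℝ≥0∞} [Fact (1 ≤ p)] [Fact (1 ≤ q)] (h : p ≤ q) (f : LpT q) :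
    (inclLp h f : Torus → ℂ) =ᵐ[normMeasure] f :=
  MemLp.coeFn_toLp ((Lp.memLp f).mono_exponent h)

theorem norm_inclLp {p q : ℝ≥0∞} [Fact (1 ≤ p)] [Fact (1 ≤ q)] (h : p ≤ q) (f : LpT q) :
    ‖inclLp h f‖ = (eLpNorm f p normMeasure).toReal := by
  rw [Lp.norm_def, eLpNorm_congr_ae (coeFn_inclLp h f)]

theorem enorm_inclLp {p q : ℝ≥0∞} [Fact (1 ≤ p)] [Fact (1 ≤ q)] (h : p ≤ q) (f : LpT q) :
    ‖inclLp h f‖ₑ = eLpNorm f p normMeasure := by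
  rw [Lp.enorm_def, eLpNorm_congr_ae (coeFn_inclLp h f)]

theorem norm_inclLp_mono {p q : ℝ≥0∞} [Fact (1 ≤ p)] [Fact (1 ≤ q)] (h : p ≤ q) {f g : LpT q}
    (hfg : ∀ᵐ t ∂normMeasure, ‖f t‖ ≤ ‖g t‖) : ‖inclLp h f‖ ≤ ‖inclLp h g‖ := by
  refine Lp.norm_le_norm_of_ae_le ?_
  filter_upwards [hfg, coeFn_inclLp h f, coeFn_inclLp h g] with t h1 h2 h3
  rwa [h2, h3]

/-! ### Approximation of nonnegative functions. -/

/-- The function takes nonnegative real values almost everywhere. -/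
def IsNonneg (f : LpT 2) : Prop := ∀ᵐ t ∂normMeasure, 0 ≤ (f t).re ∧ (f t).im = 0

/-- Approximate `s` uniformly by trigonometric polynomials `P`; then `|P|² + δ` is again one,
strictly positive, and tends to `|P|²`. -/
theorem star_mul_self_mem_closure_isPosTrig (s : C(Torus, ℂ)) :
    star s * s ∈ closure {u : C(Torus, ℂ) | IsPosTrig u} := by
  have hφ : Continuous fun P : C(Torus, ℂ) => star P * P := by fun_prop
  have hs : s ∈ closure ((fourierSubalgebra (T := 2 * Real.pi) : Set C(Torus, ℂ))) := by
    rw [← StarSubalgebra.topologicalClosure_coe, fourierSubalgebra_closure_eq_top]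
    trivial
  have h1 := image_closure_subset_closure_image hφ (Set.mem_image_of_mem _ hs)
  refine closure_minimal ?_ isClosed_closure h1
  rintro _ ⟨P, hP, rfl⟩
  have hlim : Filter.Tendsto (fun δ : ℝ => star P * P + (δ : ℂ) • (1 : C(Torus, ℂ)))
      (nhdsWithin 0 (Set.Ioi 0)) (nhds (star P * P)) := by
    have : Continuous fun δ : ℝ => star P * P + (δ : ℂ) • (1 : C(Torus, ℂ)) := by fun_prop
    have h := this.tendsto 0
    simp only [Complex.ofReal_zero, zero_smul, add_zero] at h
    exact h.mono_left nhdsWithin_le_nhds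
  refine mem_closure_of_tendsto hlim (Filter.mem_of_superset self_mem_nhdsWithin fun δ hδ => ?_)
  refine ⟨add_mem (mul_mem (star_mem hP) hP)
    (SMulMemClass.smul_mem (δ : ℂ) (one_mem fourierSubalgebra)), fun t => ?_⟩
  have hδ' : (0 : ℝ) < δ := hδ
  have : (star P * P + (δ : ℂ) • (1 : C(Torus, ℂ))) t = ((Complex.normSq (P t) + δ : ℝ) : ℂ) := by
    simp [Complex.normSq_eq_conj_mul_self]
  rw [this, Complex.ofReal_re, Complex.ofReal_im]
  exact ⟨by linarith [Complex.normSq_nonneg (P t)], rfl⟩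

theorem IsNonneg.mem_closure {f : LpT 2} (hf : IsNonneg f) :
    f ∈ closure ((fun u : C(Torus, ℂ) => u.toLp 2 normMeasure ℂ) '' {u | IsPosTrig u}) := by
  rw [← closure_closure, EMetric.mem_closure_iff]
  intro ε hε
  obtain ⟨ε', hε', hlt⟩ := exists_between hε
  have hg : MemLp (fun t => (f t).re) 2 normMeasure := (Lp.memLp f).re
  obtain ⟨h, hh, -⟩ := hg.exists_boundedContinuous_eLpNorm_sub_le (by simp) hε'.ne'
  -- The positive part of `h` is written as `s̄ s` with `s` its square root. Taking positive parts
  -- is 1-Lipschitz and fixes `Re f ≥ 0`, so the error does not grow.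
  have hc : Continuous fun t : Torus => ((Real.sqrt (max (h t) 0) : ℝ) : ℂ) := by fun_prop
  set s : C(Torus, ℂ) := ⟨_, hc⟩ with hs
  refine ⟨(star s * s).toLp 2 normMeasure ℂ, image_closure_subset_closure_image
    (ContinuousMap.toLp 2 normMeasure ℂ).continuous
    (Set.mem_image_of_mem _ (star_mul_self_mem_closure_isPosTrig s)), lt_of_le_of_lt ?_ hlt⟩
  rw [Lp.edist_def]
  refine le_trans (eLpNorm_mono_ae ?_) hh
  filter_upwards [hf, ContinuousMap.coeFn_toLp (p := 2) (𝕜 := ℂ) normMeasure (star s * s)]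
    with t ht1 ht2
  have h1 : f t = ((f t).re : ℂ) := Complex.ext rfl (by simpa using ht1.2)
  have h2 : (star s * s) t = ((max (h t) 0 : ℝ) : ℂ) := by
    simp only [hs, ContinuousMap.mul_apply, ContinuousMap.star_apply, ContinuousMap.coe_mk,
      RCLike.star_def, Complex.conj_ofReal]
    rw [← Complex.ofReal_mul, Real.mul_self_sqrt (le_max_right _ _)]
  rw [Pi.sub_apply, Pi.sub_apply, ht2, h1, h2, ← Complex.ofReal_sub, Complex.norm_real,
    Complex.ofReal_re, Real.norm_eq_abs, Real.norm_eq_abs]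
  have h3 : (f t).re = max (f t).re 0 := (max_eq_left ht1.1).symm
  calc |(f t).re - max (h t) 0| = |max (f t).re 0 - max (h t) 0| := by rw [← h3]
    _ ≤ |(f t).re - h t| := abs_max_sub_max_le_abs _ _ _

/-! ### Passage from positive polynomials to all of `L²`. -/

theorem measureReal_le_norm (f : LpT 2) {l : ℝ} (hl : 0 < l) :
    normMeasure.real {t | l ≤ ‖f t‖} ≤ 1 / l * ‖inclLp (one_le_two : (1 : ℝ≥0∞) ≤ 2) f‖ := by
  have hint : Integrable f normMeasure := (Lp.memLp f).integrable one_le_two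
  have h := mul_meas_ge_le_integral_of_nonneg (μ := normMeasure) (f := fun t => ‖f t‖)
    (Filter.Eventually.of_forall fun t => norm_nonneg _) hint.norm l
  rw [L1.norm_eq_integral_norm]
  have h2 : ∫ t, ‖inclLp (one_le_two : (1 : ℝ≥0∞) ≤ 2) f t‖ ∂normMeasure =
      ∫ t, ‖f t‖ ∂normMeasure :=
    integral_congr_ae ((coeFn_inclLp one_le_two f).fun_comp norm)
  rw [h2, one_div,
    ← div_eq_inv_mul, le_div_iff₀ hl, mul_comm]
  exact h

theorem norm_inclLp_toLp {p : ℝ≥0∞} [Fact (1 ≤ p)] (h : p ≤ 2) (u : C(Torus, ℂ)) :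
    ‖inclLp h (u.toLp 2 normMeasure ℂ)‖ = (eLpNorm u p normMeasure).toReal := by
  rw [norm_inclLp, eLpNorm_congr_ae (ContinuousMap.coeFn_toLp normMeasure u)]

theorem IsNonneg.measureReal_le {f : LpT 2} (hf : IsNonneg f) {l : ℝ} (hl : 0 < l) :
    normMeasure.real {t | l ≤ ‖hilbertTransform f t‖} ≤
      4 / l * ‖inclLp (one_le_two : (1 : ℝ≥0∞) ≤ 2) f‖ := by
  -- The measure of a level set is not continuous in the function. So `f` stays fixed on the left
  -- and the error `H (f - g)` is charged on the right, which makes the condition on `g` closed; at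
  -- `g = f` the error vanishes.
  have key : f ∈ {g : LpT 2 | normMeasure.real {t | l ≤ ‖hilbertTransform f t‖} ≤
      4 / l * ‖inclLp (one_le_two : (1 : ℝ≥0∞) ≤ 2) g‖ +
        2 / l * ‖inclLp (one_le_two : (1 : ℝ≥0∞) ≤ 2) (hilbertL (f - g))‖} := by
    refine closure_minimal ?_ (isClosed_le (by fun_prop) (by fun_prop)) hf.mem_closure
    rintro _ ⟨u, hu, rfl⟩
    have h1 := IsPosTrig.measure_le hu (half_pos hl)
    have h1' := ENNReal.toReal_mono (ENNReal.mul_ne_top ENNReal.ofReal_ne_top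
      (u.continuous.memLp_of_hasCompactSupport (p := 1) (μ := normMeasure)
        (HasCompactSupport.of_compactSpace _)).eLpNorm_ne_top) h1
    rw [ENNReal.toReal_mul, ENNReal.toReal_ofReal (by positivity), ← norm_inclLp_toLp one_le_two]
      at h1'
    have h2 := measureReal_le_norm (hilbertL (f - u.toLp 2 normMeasure ℂ)) (half_pos hl)
    have hsub : normMeasure.real {t | l ≤ ‖hilbertTransform f t‖} ≤
        normMeasure.real ({t | l / 2 ≤ ‖hilbertTransform (u.toLp 2 normMeasure ℂ) t‖} ∪
          {t | l / 2 ≤ ‖hilbertL (f - u.toLp 2 normMeasure ℂ) t‖}) := by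
      refine ENNReal.toReal_mono (measure_ne_top _ _) (measure_mono_ae ?_)
      have hadd : hilbertTransform f = hilbertTransform (u.toLp 2 normMeasure ℂ) +
          hilbertL (f - u.toLp 2 normMeasure ℂ) := by
        rw [map_sub, hilbertL_apply, hilbertL_apply]; abel
      rw [hadd]
      filter_upwards [Lp.coeFn_add (hilbertTransform (u.toLp 2 normMeasure ℂ))
        (hilbertL (f - u.toLp 2 normMeasure ℂ))] with t ht h3
      change l ≤ ‖_‖ at h3
      rw [ht, Pi.add_apply] at h3
      have h4 := h3.trans (norm_add_le _ _)
      by_contra hcon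
      change ¬ (l / 2 ≤ ‖_‖ ∨ l / 2 ≤ ‖_‖) at hcon
      push Not at hcon
      linarith [hcon.1, hcon.2]
    refine hsub.trans ((measureReal_union_le _ _).trans (add_le_add (h1'.trans_eq ?_)
      (h2.trans_eq ?_)))
    · congr 1; field_simp; norm_num
    · congr 1; field_simp
  simpa only [Set.mem_ofPred_eq, sub_self, map_zero, norm_zero, mul_zero, add_zero] using key

/-- Since `p ≤ 2`, both sides are continuous in the `L²` norm and the bound passes to the closure.
-/
theorem IsNonneg.exists_norm_le {p : ℝ≥0∞} [Fact (1 ≤ p)] (hp : 1 < p) (hp2 : p ≤ 2) :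
    ∃ C : ℝ, 0 ≤ C ∧ ∀ f : LpT 2, IsNonneg f →
      ‖inclLp hp2 (hilbertL f)‖ ≤ C * ‖inclLp hp2 f‖ := by
  obtain ⟨C, hC, h⟩ := IsPosTrig.exists_eLpNorm_le hp hp2
  refine ⟨C, hC, fun f hf => ?_⟩
  have key : f ∈ {g : LpT 2 | ‖inclLp hp2 (hilbertL g)‖ ≤ C * ‖inclLp hp2 g‖} := by
    refine closure_minimal ?_ (isClosed_le (by fun_prop) (by fun_prop)) hf.mem_closure
    rintro _ ⟨u, hu, rfl⟩
    have h1' := ENNReal.toReal_mono (ENNReal.mul_ne_top ENNReal.ofReal_ne_top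
      (u.continuous.memLp_of_hasCompactSupport (p := p) (μ := normMeasure)
        (HasCompactSupport.of_compactSpace _)).eLpNorm_ne_top) (h u hu)
    rwa [ENNReal.toReal_mul, ENNReal.toReal_ofReal hC, ← norm_inclLp_toLp hp2,
      ← norm_inclLp hp2] at h1'
  exact key

theorem exists_nonneg_decomposition (f : LpT 2) :
    ∃ g : Fin 4 → LpT 2, ∃ c : Fin 4 → ℂ, (∀ i, IsNonneg (g i)) ∧ (∀ i, ‖c i‖ = 1) ∧
      (∀ i, ∀ᵐ t ∂normMeasure, ‖g i t‖ ≤ ‖f t‖) ∧ f = ∑ i, c i • g i := by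
  have hnorm (c : ℂ) (hc : ‖c‖ = 1) (z : ℂ) : ‖((max (c * z).re 0 : ℝ) : ℂ)‖ ≤ ‖z‖ := by
    rw [Complex.norm_real, Real.norm_of_nonneg (le_max_right _ _)]
    refine max_le ((Complex.re_le_norm _).trans_eq ?_) (norm_nonneg _)
    rw [norm_mul, hc, one_mul]
  have hmem (c : ℂ) (hc : ‖c‖ = 1) :
      MemLp (fun t => ((max (c * f t).re 0 : ℝ) : ℂ)) 2 normMeasure := by
    refine (Lp.memLp f).mono ?_ (Filter.Eventually.of_forall fun t => hnorm c hc _)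
    exact (by fun_prop : Continuous fun z : ℂ => ((max (c * z).re 0 : ℝ) : ℂ))
      |>.comp_aestronglyMeasurable (Lp.aestronglyMeasurable f)
  -- These rotations are the conjugates of the coefficients `c`; the parts are the positive and
  -- negative parts of `Re f` and `Im f`.
  have hd : ∀ i, ‖(![1, -1, -Complex.I, Complex.I] : Fin 4 → ℂ) i‖ = 1 := by
    intro i; fin_cases i <;> simp
  refine ⟨fun i => (hmem _ (hd i)).toLp _, ![1, -1, Complex.I, -Complex.I], fun i => ?_,
    fun i => ?_, fun i => ?_, ?_⟩
  · filter_upwards [(hmem _ (hd i)).coeFn_toLp] with t ht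
    rw [ht, Complex.ofReal_re, Complex.ofReal_im]
    exact ⟨le_max_right _ _, rfl⟩
  · fin_cases i <;> simp
  · filter_upwards [(hmem _ (hd i)).coeFn_toLp] with t ht
    rw [ht]
    exact hnorm _ (hd i) _
  · simp only [← MemLp.toLp_const_smul, Fin.sum_univ_four, ← MemLp.toLp_add]
    refine Lp.ext (Filter.EventuallyEq.trans ?_ (MemLp.coeFn_toLp _).symm)
    refine Filter.Eventually.of_forall fun t => ?_
    have hmax (x : ℝ) : max x 0 - max (-x) 0 = x := by
      rcases le_total 0 x with h | h <;> simp [h]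
    apply Complex.ext
    · simpa [sub_eq_add_neg] using (hmax (f t).re).symm
    · simpa [sub_eq_add_neg] using (hmax (f t).im).symm

theorem measureReal_hilbertTransform_le (f : LpT 2) {l : ℝ} (hl : 0 < l) :
    normMeasure.real {t | l < ‖hilbertTransform f t‖} ≤
      64 / l * ‖inclLp (one_le_two : (1 : ℝ≥0∞) ≤ 2) f‖ := by
  obtain ⟨g, c, hg, hc, hle, hsum⟩ := exists_nonneg_decomposition f
  have hl4 : 0 < l / 4 := by positivity
  have hsub : normMeasure.real {t | l < ‖hilbertTransform f t‖} ≤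
      normMeasure.real (⋃ i, {t | l / 4 ≤ ‖hilbertTransform (g i) t‖}) := by
    refine ENNReal.toReal_mono (measure_ne_top _ _) (measure_mono_ae ?_)
    have hH : hilbertTransform f = ∑ i, c i • hilbertTransform (g i) := by
      rw [← hilbertL_apply, hsum]
      simp only [map_sum, map_smul, hilbertL_apply]
    have h2 : ∀ᵐ t ∂normMeasure, ∀ i,
        (c i • hilbertTransform (g i) : LpT 2) t = c i • hilbertTransform (g i) t :=
      ae_all_iff.2 fun i => Lp.coeFn_smul _ _
    rw [hH]
    filter_upwards [Lp.coeFn_finsetSum Finset.univ fun i => c i • hilbertTransform (g i), h2]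
      with t ht ht2 h3
    change l < ‖_‖ at h3
    rw [ht, Finset.sum_apply] at h3
    have h4 := h3.trans_le (norm_sum_le _ _)
    simp only [ht2, norm_smul, hc, one_mul] at h4
    by_contra hcon
    have hcon' : ∀ i, ‖hilbertTransform (g i) t‖ < l / 4 := by
      intro i
      by_contra h
      exact hcon (Set.mem_iUnion.2 ⟨i, not_lt.1 h⟩)
    rw [Fin.sum_univ_four] at h4
    linarith [hcon' 0, hcon' 1, hcon' 2, hcon' 3]
  refine hsub.trans ((measureReal_iUnion_fintype_le _).trans ?_)
  -- Four pieces at height `l / 4`, each costing `4 / (l / 4)`, give 64.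
  calc ∑ i, normMeasure.real {t | l / 4 ≤ ‖hilbertTransform (g i) t‖}
    _ ≤ ∑ _i : Fin 4, 4 / (l / 4) * ‖inclLp (one_le_two : (1 : ℝ≥0∞) ≤ 2) f‖ := by
      refine Finset.sum_le_sum fun i _ => ((hg i).measureReal_le hl4).trans ?_
      gcongr
      exact norm_inclLp_mono _ (hle i)
    _ = _ := by
      rw [Finset.sum_const, Finset.card_univ, Fintype.card_fin, nsmul_eq_mul]
      field_simp
      ring

theorem exists_norm_hilbertL_le {p : ℝ≥0∞} [Fact (1 ≤ p)] (hp : 1 < p) (hp2 : p ≤ 2) :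
    ∃ C : ℝ, 0 ≤ C ∧ ∀ f : LpT 2, ‖inclLp hp2 (hilbertL f)‖ ≤ C * ‖inclLp hp2 f‖ := by
  obtain ⟨C, hC, h⟩ := IsNonneg.exists_norm_le hp hp2
  refine ⟨4 * C, by positivity, fun f => ?_⟩
  obtain ⟨g, c, hg, hc, hle, hsum⟩ := exists_nonneg_decomposition f
  have hH : inclLp hp2 (hilbertL f) = ∑ i, c i • inclLp hp2 (hilbertL (g i)) := by
    rw [hsum]
    simp only [map_sum, map_smul]
  rw [hH]
  calc ‖∑ i, c i • inclLp hp2 (hilbertL (g i))‖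
    _ ≤ ∑ i, ‖c i • inclLp hp2 (hilbertL (g i))‖ := norm_sum_le _ _
    _ ≤ ∑ _i : Fin 4, C * ‖inclLp hp2 f‖ := by
      refine Finset.sum_le_sum fun i _ => ?_
      rw [norm_smul, hc, one_mul]
      refine (h _ (hg i)).trans ?_
      gcongr
      exact norm_inclLp_mono _ (hle i)
    _ = _ := by
      rw [Finset.sum_const, Finset.card_univ, Fintype.card_fin, nsmul_eq_mul]
      push_cast
      ring

/-! ### Duality and the bound for `p > 2`. -/

theorem norm_toLp_eq {p : ℝ≥0∞} [Fact (1 ≤ p)] (hp : p ≠ ∞) (u : C(Torus, ℂ)) :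
    ‖u.toLp p normMeasure ℂ‖ = (∫ t, ‖u t‖ ^ p.toReal ∂normMeasure) ^ (1 / p.toReal) := by
  have hm : MemLp u p normMeasure :=
    u.continuous.memLp_of_hasCompactSupport (HasCompactSupport.of_compactSpace _)
  rw [Lp.norm_def, eLpNorm_congr_ae (ContinuousMap.coeFn_toLp normMeasure u),
    hm.eLpNorm_eq_integral_rpow_norm (zero_lt_one.trans_le Fact.out).ne' hp,
    ENNReal.toReal_ofReal (by positivity), one_div]

theorem inclLp_toLp {p : ℝ≥0∞} [Fact (1 ≤ p)] (h : p ≤ 2) (u : C(Torus, ℂ)) :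
    inclLp h (u.toLp 2 normMeasure ℂ) = u.toLp p normMeasure ℂ :=
  Lp.ext (((coeFn_inclLp h _).trans (ContinuousMap.coeFn_toLp normMeasure u)).trans
    (ContinuousMap.coeFn_toLp normMeasure u).symm)

/-- The `L^r` bound for `r > 2`, by duality from the one for the conjugate exponent. -/
theorem exists_integral_rpow_le {r : ℝ} (hr : 2 < r) :
    ∃ C : ℝ, 0 ≤ C ∧ ∀ u v : C(Torus, ℂ),
      hilbertTransform (u.toLp 2 normMeasure ℂ) = v.toLp 2 normMeasure ℂ →
      (∫ t, ‖v t‖ ^ r ∂normMeasure) ^ (1 / r) ≤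
        C * (∫ t, ‖u t‖ ^ r ∂normMeasure) ^ (1 / r) := by
  have hrs : r.HolderConjugate (Real.conjExponent r) := .conjExponent (by linarith)
  obtain ⟨s, hs⟩ : ∃ s, s = Real.conjExponent r := ⟨_, rfl⟩
  rw [← hs] at hrs
  have hs1 : 1 < s := hrs.symm.lt
  have hs2 : s ≤ 2 := by
    rw [hs, Real.conjExponent, div_le_iff₀ (by linarith)]
    linarith
  have hq1 : 1 < ENNReal.ofReal s := by simpa using hs1
  have hq2 : ENNReal.ofReal s ≤ 2 := by
    rw [← ENNReal.ofReal_ofNat]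
    exact ENNReal.ofReal_le_ofReal hs2
  have hfact : Fact (1 ≤ ENNReal.ofReal s) := ⟨hq1.le⟩
  obtain ⟨C, hC, hbound⟩ := exists_norm_hilbertL_le hq1 hq2
  refine ⟨C, hC, fun u v huv => ?_⟩
  have hr0 : 0 < r := by linarith
  have hs0 : 0 < s := by linarith
  -- The extremal function for Hölder: `h = |v| ^ (r - 2) v` satisfies `|h| ^ s = |v| ^ r` and pairs
  -- with `v` to `∫ |v| ^ r`.
  have hhc : Continuous fun t => ((‖v t‖ ^ (r - 2) : ℝ) : ℂ) * v t := by
    refine Continuous.mul (Complex.continuous_ofReal.comp ?_) v.continuous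
    exact v.continuous.norm.rpow_const fun _ => Or.inr (by linarith)
  obtain ⟨h, hh⟩ : ∃ h : C(Torus, ℂ), ∀ t, h t = ((‖v t‖ ^ (r - 2) : ℝ) : ℂ) * v t :=
    ⟨⟨_, hhc⟩, fun _ => rfl⟩
  have hnormh (t : Torus) : ‖h t‖ ^ s = ‖v t‖ ^ r := by
    have h1 : ‖h t‖ = ‖v t‖ ^ (r - 1) := by
      rw [hh, norm_mul, Complex.norm_real, Real.norm_of_nonneg (by positivity)]
      rcases eq_or_lt_of_le (norm_nonneg (v t)) with h0 | h0
      · rw [← h0, mul_zero, Real.zero_rpow (by linarith)]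
      · rw [← Real.rpow_add_one h0.ne']
        congr 1
        ring
    rw [h1, ← Real.rpow_mul (norm_nonneg _), hrs.sub_one_mul_conj]
  have hinner : inner ℂ (h.toLp 2 normMeasure ℂ) (v.toLp 2 normMeasure ℂ) =
      ((∫ t, ‖v t‖ ^ r ∂normMeasure : ℝ) : ℂ) := by
    rw [L2.inner_def, ← integral_complex_ofReal]
    refine integral_congr_ae ?_
    filter_upwards [ContinuousMap.coeFn_toLp (p := 2) (𝕜 := ℂ) normMeasure h,
      ContinuousMap.coeFn_toLp (p := 2) (𝕜 := ℂ) normMeasure v] with t h1 h2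
    rw [h1, h2, RCLike.inner_apply, hh, map_mul, Complex.conj_ofReal, mul_left_comm,
      Complex.mul_conj, Complex.normSq_eq_norm_sq, ← Complex.ofReal_mul]
    congr 1
    rcases eq_or_lt_of_le (norm_nonneg (v t)) with h0 | h0
    · rw [← h0, Real.zero_rpow (by linarith : r ≠ 0)]
      simp
    · rw [← Real.rpow_natCast, ← Real.rpow_add h0]
      congr 1
      push_cast
      ring
  set w := hilbertTransform (h.toLp 2 normMeasure ℂ) with hw
  have hV0 : 0 ≤ ∫ t, ‖v t‖ ^ r ∂normMeasure := integral_nonneg fun t => by positivity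
  have hwmem : MemLp w (ENNReal.ofReal s) normMeasure := (Lp.memLp w).mono_exponent hq2
  have humem : MemLp u (ENNReal.ofReal r) normMeasure :=
    u.continuous.memLp_of_hasCompactSupport (HasCompactSupport.of_compactSpace _)
  have hwnorm : (∫ t, ‖w t‖ ^ s ∂normMeasure) ^ (1 / s) ≤
      C * (∫ t, ‖v t‖ ^ r ∂normMeasure) ^ (1 / s) := by
    have h1 := hbound (h.toLp 2 normMeasure ℂ)
    rw [inclLp_toLp, norm_toLp_eq ENNReal.ofReal_ne_top, norm_inclLp, hilbertL_apply, ← hw,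
      hwmem.eLpNorm_eq_integral_rpow_norm (zero_lt_one.trans hq1).ne' ENNReal.ofReal_ne_top,
      ENNReal.toReal_ofReal (by positivity), ENNReal.toReal_ofReal hs0.le] at h1
    simpa only [hnormh, one_div] using h1
  -- Here `∫ |v| ^ r = |⟨h, Hu⟩| = |⟨Hh, u⟩| ≤ ‖Hh‖_s ‖u‖_r`, and the bound for `s ≤ 2` applies to
  -- `Hh`.
  have hmain : ∫ t, ‖v t‖ ^ r ∂normMeasure ≤ C * (∫ t, ‖v t‖ ^ r ∂normMeasure) ^ (1 / s) *
      (∫ t, ‖u t‖ ^ r ∂normMeasure) ^ (1 / r) := by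
    have h1 : ∫ t, ‖v t‖ ^ r ∂normMeasure =
        ‖inner ℂ w (u.toLp 2 normMeasure ℂ)‖ := by
      rw [hw, inner_hilbertTransform_left, huv, hinner, norm_neg, Complex.norm_real,
        Real.norm_of_nonneg hV0]
    refine h1.trans_le ?_
    rw [L2.inner_def]
    refine (norm_integral_le_integral_norm _).trans ?_
    have h2 : ∫ t, ‖inner ℂ (w t) (u.toLp 2 normMeasure ℂ t)‖ ∂normMeasure =
        ∫ t, ‖w t‖ * ‖u t‖ ∂normMeasure := by
      refine integral_congr_ae ?_
      filter_upwards [ContinuousMap.coeFn_toLp (p := 2) (𝕜 := ℂ) normMeasure u] with t ht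
      rw [ht, RCLike.inner_apply, norm_mul, RCLike.norm_conj, mul_comm]
    rw [h2]
    refine (integral_mul_norm_le_Lp_mul_Lq hrs.symm hwmem humem).trans ?_
    gcongr
  -- It remains to divide by `(∫ |v| ^ r) ^ (1 / s)`, which must be nonzero.
  rcases eq_or_lt_of_le hV0 with h0 | h0
  · rw [← h0, Real.zero_rpow (by positivity)]
    exact mul_nonneg hC (Real.rpow_nonneg (integral_nonneg fun t => by positivity) _)
  · have hsplit : (∫ t, ‖v t‖ ^ r ∂normMeasure) ^ (1 / s) *
        (∫ t, ‖v t‖ ^ r ∂normMeasure) ^ (1 / r) = ∫ t, ‖v t‖ ^ r ∂normMeasure := by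
      rw [← Real.rpow_add h0, one_div, one_div, hrs.symm.inv_add_inv_eq_one, Real.rpow_one]
    have hpos : 0 < (∫ t, ‖v t‖ ^ r ∂normMeasure) ^ (1 / s) := Real.rpow_pos_of_pos h0 _
    refine le_of_mul_le_mul_left ?_ hpos
    rw [hsplit]
    linarith

/-- Continuity of the transform `v` makes its `L^p` norm finite in advance, so small and large `p`
can be stated alike. Trigonometric polynomials supply enough such pairs. -/
theorem exists_norm_toLp_le {p : ℝ≥0∞} [Fact (1 ≤ p)] (hp : 1 < p) (hptop : p ≠ ∞) :
    ∃ C : ℝ, 0 ≤ C ∧ ∀ u v : C(Torus, ℂ),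
      hilbertTransform (u.toLp 2 normMeasure ℂ) = v.toLp 2 normMeasure ℂ →
      ‖v.toLp p normMeasure ℂ‖ ≤ C * ‖u.toLp p normMeasure ℂ‖ := by
  rcases le_or_gt p 2 with h2 | h2
  · obtain ⟨C, hC, h⟩ := exists_norm_hilbertL_le hp h2
    refine ⟨C, hC, fun u v huv => ?_⟩
    rw [← inclLp_toLp h2, ← inclLp_toLp h2, ← huv]
    exact h _
  · have hr : 2 < p.toReal := by
      rw [← ENNReal.toReal_ofNat]
      exact (ENNReal.toReal_lt_toReal (by simp) hptop).2 h2
    obtain ⟨C, hC, h⟩ := exists_integral_rpow_le hr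
    refine ⟨C, hC, fun u v huv => ?_⟩
    rw [norm_toLp_eq hptop, norm_toLp_eq hptop]
    exact h u v huv

/-! ### Extension to `L^p` by density. -/

theorem dense_span_fourierLp {p : ℝ≥0∞} [Fact (1 ≤ p)] (hp : p ≠ ∞) :
    Dense (Submodule.span ℂ (Set.range (fourierLp (T := 2 * Real.pi) p)) : Set (LpT p)) :=
  (Submodule.dense_iff_topologicalClosure_eq_top).2 (span_fourierLp_closure_eq_top hp)

theorem exists_extension {p : ℝ≥0∞} [Fact (1 ≤ p)] (hp : 1 < p) (hptop : p ≠ ∞) :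
    ∃ T : LpT p →L[ℂ] LpT p, (∃ C : ℝ, 0 ≤ C ∧ ∀ f, ‖T f‖ ≤ C * ‖f‖) ∧
      ∀ n, T (fourierLp p n) = multiplier n • fourierLp p n := by
  obtain ⟨C, hC, h⟩ := exists_norm_toLp_le hp hptop
  let e : (ℤ →₀ ℂ) →ₗ[ℂ] LpT p := Finsupp.linearCombination ℂ (fourierLp p)
  let f : (ℤ →₀ ℂ) →ₗ[ℂ] LpT p :=
    Finsupp.linearCombination ℂ fun n => multiplier n • fourierLp p n
  have hdense : DenseRange e := by
    have := dense_span_fourierLp hptop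
    rw [← Finsupp.range_linearCombination] at this
    exact this
  have hbound (c : ℤ →₀ ℂ) : ‖f c‖ ≤ C * ‖e c‖ := by
    have he (q : ℝ≥0∞) [Fact (1 ≤ q)] : Finsupp.linearCombination ℂ (fourierLp q) c =
        (Finsupp.linearCombination ℂ (fourier (T := 2 * Real.pi)) c).toLp q normMeasure ℂ := by
      simp only [Finsupp.linearCombination_apply, Finsupp.sum, map_sum, map_smul]
    have hf (q : ℝ≥0∞) [Fact (1 ≤ q)] :
        Finsupp.linearCombination ℂ (fun n => multiplier n • fourierLp q n) c =
        (Finsupp.linearCombination ℂ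
          (fun n => multiplier n • fourier (T := 2 * Real.pi) n) c).toLp q normMeasure ℂ := by
      simp only [Finsupp.linearCombination_apply, Finsupp.sum, map_sum, map_smul]
    have := h (Finsupp.linearCombination ℂ (fourier (T := 2 * Real.pi)) c)
      (Finsupp.linearCombination ℂ (fun n => multiplier n • fourier (T := 2 * Real.pi) n) c) (by
      rw [← he, ← hf, ← hilbertL_apply]
      simp only [Finsupp.linearCombination_apply, Finsupp.sum, map_sum, map_smul, hilbertL_apply,
        hilbertTransform_fourierLp])
    rwa [← he, ← hf] at this
  refine ⟨f.extendOfNorm e, ⟨C, hC, LinearMap.norm_extendOfNorm_apply_le hdense C hbound⟩,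
    fun n => ?_⟩
  have := LinearMap.extendOfNorm_eq hdense ⟨C, hbound⟩ (Finsupp.single n 1)
  simpa [e, f] using this

/-! ### Fourier coefficients, agreement with `L²`, and uniqueness. -/

theorem integrable_Lp {p : ℝ≥0∞} [Fact (1 ≤ p)] (f : LpT p) : Integrable f normMeasure :=
  (Lp.memLp f).integrable Fact.out

/-- The `n`-th Fourier coefficient as a continuous linear functional on `L^p`. -/
def fourierCoeffL (p : ℝ≥0∞) [Fact (1 ≤ p)] (n : ℤ) : LpT p →L[ℂ] ℂ :=
  LinearMap.mkContinuous
    { toFun := fun f => fourierCoeff (f : Torus → ℂ) n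
      map_add' := fun f g => by
        rw [fourierCoeff_congr_ae (Lp.coeFn_add f g),
          fourierCoeff.add (integrable_Lp f) (integrable_Lp g), Pi.add_apply]
      map_smul' := fun c f => by
        rw [fourierCoeff_congr_ae (Lp.coeFn_smul c f), fourierCoeff.const_smul,
          RingHom.id_apply] } 1 (fun f => by
      rw [one_mul]
      refine (norm_integral_le_integral_norm _).trans ?_
      have h1 : ∫ t, ‖fourier (-n) t • f t‖ ∂normMeasure = ∫ t, ‖f t‖ ∂normMeasure := by
        refine integral_congr_ae (Filter.Eventually.of_forall fun t => ?_)
        simp only [norm_smul, fourier_apply, Circle.norm_coe, one_mul]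
      refine h1.trans_le ?_
      rw [Lp.norm_def, integral_norm_eq_lintegral_enorm (Lp.aestronglyMeasurable f),
        ← eLpNorm_one_eq_lintegral_enorm]
      exact ENNReal.toReal_mono (Lp.eLpNorm_ne_top f)
        (eLpNorm_le_eLpNorm_of_exponent_le Fact.out (Lp.aestronglyMeasurable f)))

theorem fourierCoeffL_apply (p : ℝ≥0∞) [Fact (1 ≤ p)] (n : ℤ) (f : LpT p) :
    fourierCoeffL p n f = fourierCoeff (f : Torus → ℂ) n := rfl

theorem fourierCoeff_of_apply_fourierLp {p : ℝ≥0∞} [Fact (1 ≤ p)] (hptop : p ≠ ∞)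
    {T : LpT p →L[ℂ] LpT p} (hT : ∀ n, T (fourierLp p n) = multiplier n • fourierLp p n)
    (f : LpT p) (n : ℤ) :
    fourierCoeff (T f : Torus → ℂ) n = multiplier n * fourierCoeff (f : Torus → ℂ) n := by
  have h : (fourierCoeffL p n).comp T = multiplier n • fourierCoeffL p n := by
    refine ContinuousLinearMap.ext_on (dense_span_fourierLp hptop) ?_
    rintro _ ⟨m, rfl⟩
    rw [ContinuousLinearMap.comp_apply, hT, map_smul, _root_.smul_apply,
      fourierCoeffL_apply, fourierCoeff_congr_ae (coeFn_fourierLp p m), fourierCoeff_fourier]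
    rcases eq_or_ne n m with rfl | hne
    · rfl
    · simp [hne]
  exact congrArg (fun L : LpT p →L[ℂ] ℂ => L f) h

theorem inclLp_fourierLp {p q : ℝ≥0∞} [Fact (1 ≤ p)] [Fact (1 ≤ q)] (h : p ≤ q) (n : ℤ) :
    inclLp h (fourierLp q n) = fourierLp p n :=
  Lp.ext (((coeFn_inclLp h _).trans (coeFn_fourierLp q n)).trans (coeFn_fourierLp p n).symm)

/-- Compare in the larger space: two continuous maps from the smaller of `L²` and `L^p` into the
larger agree on exponentials, which span a dense subspace of the smaller. -/
theorem extendsHilbertTransform_of_apply_fourierLp {p : ℝ≥0∞} [Fact (1 ≤ p)] (hptop : p ≠ ∞)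
    {T : LpT p →L[ℂ] LpT p} (hT : ∀ n, T (fourierLp p n) = multiplier n • fourierLp p n) :
    ExtendsHilbertTransform p T := by
  intro f g hfg
  rcases le_total p 2 with h2 | h2
  · have hcomp : T.comp (inclLp h2) = (inclLp h2).comp hilbertL := by
      refine ContinuousLinearMap.ext_on (dense_span_fourierLp (by simp)) ?_
      rintro _ ⟨n, rfl⟩
      rw [ContinuousLinearMap.comp_apply, ContinuousLinearMap.comp_apply, inclLp_fourierLp, hT,
        hilbertL_apply, hilbertTransform_fourierLp, map_smul, inclLp_fourierLp]
    have hg : g = inclLp h2 f := Lp.ext (hfg.symm.trans (coeFn_inclLp h2 f).symm)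
    have h := congrArg (fun L : LpT 2 →L[ℂ] LpT p => L f) hcomp
    simp only [ContinuousLinearMap.comp_apply, ← hg] at h
    rw [h]
    exact coeFn_inclLp h2 _
  · have hcomp : (inclLp h2).comp T = hilbertL.comp (inclLp h2) := by
      refine ContinuousLinearMap.ext_on (dense_span_fourierLp hptop) ?_
      rintro _ ⟨n, rfl⟩
      rw [ContinuousLinearMap.comp_apply, ContinuousLinearMap.comp_apply, inclLp_fourierLp, hT,
        hilbertL_apply, hilbertTransform_fourierLp, map_smul, inclLp_fourierLp]
    have hf : f = inclLp h2 g := Lp.ext (hfg.trans (coeFn_inclLp h2 g).symm)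
    have h := congrArg (fun L : LpT p →L[ℂ] LpT 2 => L g) hcomp
    simp only [ContinuousLinearMap.comp_apply, ← hf, hilbertL_apply] at h
    rw [← h]
    exact (coeFn_inclLp h2 _).symm

/-- Exponentials lie in `L² ∩ L^p`, so every extension has the same values on them; with density
this gives uniqueness. -/
theorem ExtendsHilbertTransform.apply_fourierLp {p : ℝ≥0∞} [Fact (1 ≤ p)]
    {S : LpT p → LpT p} (hS : ExtendsHilbertTransform p S) (n : ℤ) :
    S (fourierLp p n) = multiplier n • fourierLp p n := by
  refine Lp.ext ((hS (fourierLp 2 n) (fourierLp p n)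
    ((coeFn_fourierLp 2 n).trans (coeFn_fourierLp p n).symm)).trans ?_)
  rw [hilbertTransform_fourierLp]
  filter_upwards [Lp.coeFn_smul (multiplier n) (fourierLp 2 n : LpT 2),
    Lp.coeFn_smul (multiplier n) (fourierLp p n : LpT p),
    coeFn_fourierLp (T := 2 * Real.pi) 2 n, coeFn_fourierLp (T := 2 * Real.pi) p n]
    with t h1 h2 h3 h4
  rw [h1, h2, Pi.smul_apply, Pi.smul_apply, h3, h4]

theorem volume_hilbertTransform_le (f : LpT 2) {l : ℝ} (hl : 0 < l) :
    volume {t : Torus | l < ‖hilbertTransform f t‖} ≤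
      ENNReal.ofReal (2 * Real.pi * 64 / l) * eLpNorm f 1 normMeasure := by
  -- Only the left side uses Lebesgue measure, hence the extra `2π`.
  rw [volume_eq_smul_haarAddCircle, Measure.smul_apply, smul_eq_mul, ← ofReal_measureReal,
    ← enorm_inclLp one_le_two, ← ofReal_norm, ← ENNReal.ofReal_mul Real.two_pi_pos.le,
    ← ENNReal.ofReal_mul (by positivity), mul_div_assoc, mul_assoc (2 * Real.pi)]
  exact ENNReal.ofReal_le_ofReal (mul_le_mul_of_nonneg_left (measureReal_hilbertTransform_le f hl)
    Real.two_pi_pos.le)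

end CircleHilbert

end

theorem corollary12p2 :
    (∃ A : ℝ, 0 < A ∧ ∀ (f : CircleHilbert.LpT 2) (l : ℝ), 0 < l →
      volume {t : CircleHilbert.Torus | l < ‖CircleHilbert.hilbertTransform f t‖} ≤
        ENNReal.ofReal (A / l) * eLpNorm f 1 CircleHilbert.normMeasure) ∧
    (∀ (p : ℝ≥0∞) [Fact (1 ≤ p)], 1 < p → p ≠ ∞ →
      ∃ T : CircleHilbert.LpT p →L[ℂ] CircleHilbert.LpT p,
        CircleHilbert.ExtendsHilbertTransform p T ∧
        (∀ S : CircleHilbert.LpT p →L[ℂ] CircleHilbert.LpT p,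
          CircleHilbert.ExtendsHilbertTransform p S → S = T) ∧
        (∃ C : ℝ, 0 < C ∧ ∀ f : CircleHilbert.LpT p, ‖T f‖ ≤ C * ‖f‖) ∧
        ∀ (f : CircleHilbert.LpT p) (n : ℤ),
          fourierCoeff (T f : CircleHilbert.Torus → ℂ) n =
            -Complex.I * ((Int.sign n : ℤ) : ℂ) *
              fourierCoeff (f : CircleHilbert.Torus → ℂ) n) := by
  refine ⟨⟨2 * Real.pi * 64, by positivity,
    fun f l hl => CircleHilbert.volume_hilbertTransform_le f hl⟩, fun p _ hp hptop => ?_⟩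
  obtain ⟨T, ⟨C, hC, hTC⟩, hT⟩ := CircleHilbert.exists_extension hp hptop
  refine ⟨T, CircleHilbert.extendsHilbertTransform_of_apply_fourierLp hptop hT,
    -- `C` may be zero; `C + 1` is a strictly positive constant.
    fun S hS => ?_, ⟨C + 1, by positivity, fun f => (hTC f).trans ?_⟩,
    CircleHilbert.fourierCoeff_of_apply_fourierLp hptop hT⟩
  · refine ContinuousLinearMap.ext_on (CircleHilbert.dense_span_fourierLp hptop) ?_
    rintro _ ⟨n, rfl⟩
    rw [hS.apply_fourierLp, hT]
  · gcongr
    linarith
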